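/- A partition of a nonnegative integer $n$ is a nonincreasing finite sequence of positive integers (its parts) with sum $n$. Let $\overline{\mathcal{EO}}(n)$ denote the number of partitions of $n$ in which every even part is less than each odd part and in which only the largest even part appears an odd number of times; that is, the largest even part, if there is an even part, appears an odd number of times, and every other part appears an even number of times (in particular, if there is no even part, every part appears an even number of times). Let $t \in \{1,2,3,4\}$. Then for all integers $n \ge 0$, $$\overline{\mathcal{EO}}\bigl(10(5n+t)+8\bigr) \equiv 0 \pmod{20}.$$ -/

import Mathlib

/-- A partition in which every even part is less than each odd part. -/
def IsEO {n : ℕ} (p : n.Partition) : Prop :=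
  ∀ a ∈ p.parts, ∀ b ∈ p.parts, Even a → Odd b → a < b

/-- `a` is the largest even part of the partition `p`. -/
def IsLargestEvenPart {n : ℕ} (p : n.Partition) (a : ℕ) : Prop :=
  a ∈ p.parts ∧ Even a ∧ ∀ b ∈ p.parts, Even b → b ≤ a

/-- A partition in which every even part is less than each odd part, and in which only the
largest even part appears an odd number of times: a part has odd multiplicity exactly when it is
the largest even part. (If there is no even part, every part has even multiplicity.) -/
def IsEOBar {n : ℕ} (p : n.Partition) : Prop :=
  IsEO p ∧ ∀ a ∈ p.parts, Odd (p.parts.count a) ↔ IsLargestEvenPart p a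

instance {n : ℕ} : DecidablePred (IsEO (n := n)) := fun p => by
  unfold IsEO; infer_instance

instance {n : ℕ} (p : n.Partition) : DecidablePred (IsLargestEvenPart p) := fun a => by
  unfold IsLargestEvenPart; infer_instance

instance {n : ℕ} : DecidablePred (IsEOBar (n := n)) := fun p => by
  unfold IsEOBar; infer_instance

/-- The number of partitions of `n` satisfying `IsEOBar`. -/
def EOBar (n : ℕ) : ℕ :=
  ((Finset.univ : Finset n.Partition).filter IsEOBar).card

/-! # A congruence modulo 20 for `EOBar`

Write `f_m = ∏ i ≥ 1, (1 - X ^ (m * i))`. Removing one copy of the largest even part `2 * k` from a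
partition counted by `EOBar (2 * n)` (nothing if there is no even part, `k = 0`) leaves a partition
with even multiplicities, the double of a partition of `n - k` whose even parts are at most `2 * k`
and whose odd parts exceed `2 * k`. Summing the generating functions of the latter over `k` by the
`q`-binomial theorem gives `∑ EOBar (2 * n) X ^ n = f_2 ^ 3 / f_1 ^ 2`
(`EOBarSeries_mul_eulerSeries_one_sq`). The theorem concerns the coefficients of `X ^ N` in this
series with `N = 5 * (5 * n + t) + 4`.

Modulo `5` the series is `f_1 ^ 3 * f_2 ^ 3 / f_5`. By Jacobi's identity
`f_1 ^ 3 = ∑ (-1) ^ m (2 * m + 1) X ^ (m * (m + 1) / 2)`, the coefficient of `X ^ N` in the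
numerator is a sum over the solutions of `8 * N + 3 = y ^ 2 + 2 * z ^ 2`, weighted by multiples of
`y * z`. For `N` congruent to `4` modulo `5` the left-hand side is divisible by `5`, and
`y ^ 2 + 2 * z ^ 2` is anisotropic modulo `5`, so the weights vanish;
the denominator is a series in `X ^ 5`
(`coeff_EOBarSeries_zmod_five`).

Modulo `4` one has `f_1 ^ 2 = f_2 * (1 + 2 * D(X))`, where `D(X) = ∑ d(n) X ^ n` is congruent to
`∑ y ≥ 1, X ^ (y ^ 2)` modulo `2`. Hence the series is `f_4 * (1 + 2 * D(X) + 2 * D(X ^ 2))`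
(`EOBarSeries_eq_of_four_eq_zero`), and by the pentagonal number theorem the coefficient of `X ^ N`
is governed by the representations of `6 * N + 1` by `x ^ 2`, by `x ^ 2 + 6 * y ^ 2` and by
`x ^ 2 + 12 * y ^ 2`. Since `t` is prime to `5`, the prime `5` divides `6 * N + 1` exactly once.
This rules out the first and the third form, and it makes the number of representations by the
second one even: exchanging the two primes of `ℤ[√-6]` above `5` is an involution without
fixed points (`even_card_sq_add_six_mul_sq`). So this coefficient vanishes modulo `4`
(`coeff_EOBarSeries_eq_zero_of_four_eq_zero`).

The identities between power series are proved modulo `X ^ K` for all `K`, where `X` is nilpotent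
and all products and sums are finite. -/

open PowerSeries Finset

/-! ### Gaussian binomial coefficients and the finite Jacobi identity -/

/-- The finite product `(q; q)_n = (1 - q)(1 - q ^ 2) ⋯ (1 - q ^ n)`. -/
def qProd {A : Type*} [CommRing A] (q : A) (n : ℕ) : A := ∏ i ∈ range n, (1 - q ^ (i + 1))

/-- The Gaussian binomial coefficient at `q`, defined by the `q`-Pascal rule so that it makes sense
in every commutative ring, without division. -/
def qBinom {A : Type*} [CommRing A] (q : A) : ℕ → ℕ → A
  | _, 0 => 1
  | 0, _ + 1 => 0
  | n + 1, k + 1 => qBinom q n k + q ^ (k + 1) * qBinom q n (k + 1)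

section Finite
variable {A B : Type*} [CommRing A] [CommRing B] (q : A)

@[simp] lemma qBinom_zero_right (n : ℕ) : qBinom q n 0 = 1 := by cases n <;> rfl

lemma qBinom_succ_succ (n k : ℕ) :
    qBinom q (n + 1) (k + 1) = qBinom q n k + q ^ (k + 1) * qBinom q n (k + 1) := rfl

lemma qBinom_eq_zero {n k : ℕ} (h : n < k) : qBinom q n k = 0 := by
  induction n generalizing k with
  | zero => obtain ⟨k, rfl⟩ := Nat.exists_eq_succ_of_ne_zero h.ne'; rfl
  | succ n ih =>
    obtain ⟨k, rfl⟩ := Nat.exists_eq_succ_of_ne_zero (by omega : k ≠ 0)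
    rw [Nat.succ_eq_add_one, qBinom_succ_succ, ih (by omega), ih (by omega), mul_zero, add_zero]

@[simp] lemma qBinom_self (n : ℕ) : qBinom q n n = 1 := by
  induction n with
  | zero => rfl
  | succ n ih => rw [qBinom_succ_succ, ih, qBinom_eq_zero q n.lt_succ_self, mul_zero, add_zero]

@[simp] lemma qProd_zero : qProd q 0 = 1 := rfl

lemma qProd_succ (n : ℕ) : qProd q (n + 1) = qProd q n * (1 - q ^ (n + 1)) :=
  prod_range_succ _ _

lemma map_qProd {F : Type*} [FunLike F A B] [RingHomClass F A B] (f : F) (n : ℕ) :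
    f (qProd q n) = qProd (f q) n := by
  simp [qProd]

/-- The division-free form of `[a + k choose k] = (q; q)_{a+k} / ((q; q)_k (q; q)_a)`. -/
lemma qBinom_mul_qProd_mul_qProd (a k : ℕ) :
    qBinom q (a + k) k * qProd q k * qProd q a = qProd q (a + k) := by
  induction k generalizing a with
  | zero => simp
  | succ k ihk =>
    induction a with
    | zero => simp
    | succ a iha =>
      have h := ihk (a + 1)
      rw [show a + 1 + (k + 1) = (a + 1 + k) + 1 by ring, qBinom_succ_succ]
      rw [show a + (k + 1) = a + 1 + k by ring] at iha
      rw [qProd_succ q (a + 1 + k), qProd_succ q k]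
      rw [qProd_succ q k] at iha
      rw [qProd_succ q a] at h ⊢
      linear_combination (1 - q ^ (k + 1)) * h + q ^ (k + 1) * (1 - q ^ (a + 1)) * iha

/-- The `q`-binomial theorem, in homogeneous form. -/
theorem prod_add_mul_pow (x y : A) (n : ℕ) :
    ∏ i ∈ range n, (y + x * q ^ i) =
      ∑ k ∈ range (n + 1), q ^ k.choose 2 * qBinom q n k * x ^ k * y ^ (n - k) := by
  induction n generalizing x with
  | zero => simp
  | succ n ih =>
    rw [prod_range_succ', pow_zero, mul_one]
    have h : ∀ i, y + x * q ^ (i + 1) = y + (x * q) * q ^ i := fun i => by ring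
    simp_rw [h]
    rw [ih, sum_range_succ' _ (n + 1)]
    simp_rw [qBinom_succ_succ]
    have h1 : ∀ k ∈ range (n + 1),
        q ^ (k + 1).choose 2 * (qBinom q n k + q ^ (k + 1) * qBinom q n (k + 1)) * x ^ (k + 1) *
          y ^ (n + 1 - (k + 1)) =
        x * (q ^ k.choose 2 * qBinom q n k * (x * q) ^ k * y ^ (n - k)) +
        q ^ (k + 1).choose 2 * qBinom q n (k + 1) * (x * q) ^ (k + 1) * y ^ (n - k) := by
      intro k _
      have : (k + 1).choose 2 = k + k.choose 2 := by
        rw [Nat.choose_succ_succ' k 1, Nat.choose_one_right]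
      rw [Nat.add_sub_add_right, this]
      ring
    rw [sum_congr rfl h1, sum_add_distrib, ← mul_sum]
    have h2 : ∑ k ∈ range (n + 1), q ^ (k + 1).choose 2 * qBinom q n (k + 1) * (x * q) ^ (k + 1) *
        y ^ (n - k) + y ^ (n + 1) =
        y * ∑ k ∈ range (n + 1), q ^ k.choose 2 * qBinom q n k * (x * q) ^ k * y ^ (n - k) := by
      rw [sum_range_succ, qBinom_eq_zero q n.lt_succ_self, sum_range_succ' _ n, mul_add, mul_sum]
      simp only [mul_zero, zero_mul, add_zero, Nat.choose_zero_succ, pow_zero, one_mul,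
        qBinom_zero_right, Nat.sub_zero]
      rw [pow_succ' y n]
      congr 1
      refine sum_congr rfl fun k hk => ?_
      rw [mem_range] at hk
      rw [show n - k = (n - (k + 1)) + 1 by omega, pow_succ]
      ring
    simp only [Nat.choose_zero_succ, pow_zero, qBinom_zero_right, Nat.sub_zero, one_mul] at *
    rw [add_assoc, h2]
    ring

/-- The derivative of the `q`-binomial theorem for `∏ i < 2 * N + 1, (Y - q ^ i)` at its root
`Y = q ^ N`: on the left only the term in which the factor `Y - q ^ N` is differentiated
survives. -/
lemma prod_erase_pow_sub_pow (N : ℕ) :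
    ∏ i ∈ (range (2 * N + 1)).erase N, (q ^ N - q ^ i) =
      ∑ k ∈ range (2 * N + 2), ((2 * N + 1 - k : ℕ) : A) *
        (q ^ k.choose 2 * qBinom q (2 * N + 1) k * (-1) ^ k * q ^ (N * (2 * N + 1 - k - 1))) := by
  have h := congrArg (fun p => (Polynomial.derivative p).eval (q ^ N))
    (prod_add_mul_pow (Polynomial.C q) (-1) Polynomial.X (2 * N + 1))
  have hN : N ∈ range (2 * N + 1) := mem_range.2 (by omega)
  have hb : ∀ n k, qBinom (Polynomial.C q : Polynomial A) n k = Polynomial.C (qBinom q n k) := by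
    intro n
    induction n with
    | zero => intro k; cases k <;> simp [qBinom]
    | succ n ih => intro k; cases k <;> simp [qBinom_succ_succ, ih]
  rw [← mul_prod_erase _ _ hN] at h
  simp only [Polynomial.derivative_mul, Polynomial.eval_add, Polynomial.eval_mul,
    Polynomial.derivative_add, Polynomial.derivative_X, hb] at h
  simp only [Polynomial.derivative_sum, Polynomial.eval_finsetSum] at h
  convert h using 1
  · simp only [Polynomial.eval_prod]
    have : ∀ n, Polynomial.derivative (Polynomial.C q ^ n) = 0 := fun n => by
      rw [← map_pow, Polynomial.derivative_C]
    simp [← sub_eq_add_neg, this]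
  · refine sum_congr rfl fun k _ => ?_
    have : (Polynomial.C q ^ k.choose 2 * Polynomial.C (qBinom q (2 * N + 1) k) * (-1) ^ k :
      Polynomial A) =
      Polynomial.C (q ^ k.choose 2 * qBinom q (2 * N + 1) k * (-1) ^ k) := by simp
    rw [this, Polynomial.derivative_C_mul, Polynomial.derivative_X_pow]
    simp [pow_mul]
    ring

lemma two_mul_cast_choose_two (n : ℕ) : 2 * ((n.choose 2 : ℕ) : ℤ) = n * (n - 1) := by
  induction n with
  | zero => simp
  | succ n ih => rw [Nat.choose_succ_succ' n 1, Nat.choose_one_right]; push_cast; linarith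

/-- The power of `q` in the term `k = N - m` of `prod_erase_pow_sub_pow`. -/
lemma choose_two_add_mul_of_le {N m : ℕ} (h : m ≤ N) :
    (N - m).choose 2 + N * (2 * N + 1 - (N - m) - 1) = (N.choose 2 + N ^ 2) + (m + 1).choose 2 := by
  obtain ⟨d, rfl⟩ := Nat.exists_eq_add_of_le h
  have e1 : m + d - m = d := by omega
  have e2 : 2 * (m + d) + 1 - d - 1 = 2 * m + d := by omega
  rw [e1, e2]
  zify
  have h1 := two_mul_cast_choose_two d
  have h2 := two_mul_cast_choose_two (m + d)
  have h3 := two_mul_cast_choose_two (m + 1)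
  push_cast at *
  nlinarith

/-- The power of `q` in the term `k = N + 1 + m` of `prod_erase_pow_sub_pow`; it is the same as in
the term `k = N - m`. -/
lemma choose_two_add_mul_of_lt {N m : ℕ} (h : m < N) :
    (N + 1 + m).choose 2 + N * (2 * N + 1 - (N + 1 + m) - 1) =
      (N.choose 2 + N ^ 2) + (m + 1).choose 2 := by
  obtain ⟨d, rfl⟩ := Nat.exists_eq_add_of_lt h
  have e2 : 2 * (m + d + 1) + 1 - (m + d + 1 + 1 + m) - 1 = d := by omega
  rw [e2]
  zify
  have h1 := two_mul_cast_choose_two (m + d + 1 + 1 + m)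
  have h2 := two_mul_cast_choose_two (m + d + 1)
  have h3 := two_mul_cast_choose_two (m + 1)
  push_cast at *
  nlinarith

lemma qBinom_symm_two_mul_add_one {N m : ℕ} [IsDomain A] (hq : ∀ i : ℕ, 1 - q ^ (i + 1) ≠ 0)
    (h : m ≤ N) : qBinom q (2 * N + 1) (N + 1 + m) = qBinom q (2 * N + 1) (N - m) := by
  have hP : ∀ n, qProd q n ≠ 0 := fun n => prod_ne_zero_iff.2 fun i _ => hq i
  have h1 := qBinom_mul_qProd_mul_qProd q (N - m) (N + 1 + m)
  have h2 := qBinom_mul_qProd_mul_qProd q (N + 1 + m) (N - m)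
  rw [show N - m + (N + 1 + m) = 2 * N + 1 by omega] at h1
  rw [show N + 1 + m + (N - m) = 2 * N + 1 by omega] at h2
  refine mul_right_cancel₀ (hP (N + 1 + m)) (mul_right_cancel₀ (hP (N - m)) ?_)
  rw [h1, ← h2]
  ring

lemma prod_erase_pow_sub_pow_eq_qProd_sq (N : ℕ) :
    ∏ i ∈ (range (2 * N + 1)).erase N, (q ^ N - q ^ i) =
      (-1) ^ N * q ^ (N.choose 2 + N ^ 2) * qProd q N ^ 2 := by
  have hs : (range (2 * N + 1)).erase N = range N ∪ (range N).map (addLeftEmbedding (N + 1)) := by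
    ext i
    simp only [mem_erase, mem_range, mem_union, mem_map, addLeftEmbedding_apply]
    constructor
    · intro h
      by_cases hi : i < N
      · exact Or.inl hi
      · exact Or.inr ⟨i - (N + 1), by omega, by omega⟩
    · rintro (h | ⟨a, h, rfl⟩) <;> omega
  have hd : Disjoint (range N) ((range N).map (addLeftEmbedding (N + 1))) := by
    rw [disjoint_left]
    intro i hi
    simp only [mem_range, mem_map, addLeftEmbedding_apply, not_exists, not_and] at *
    omega
  rw [hs, prod_union hd, prod_map]
  have h1 : ∏ i ∈ range N, (q ^ N - q ^ i) = (-1) ^ N * q ^ N.choose 2 * qProd q N := by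
    have : ∀ i ∈ range N, q ^ N - q ^ i = -1 * q ^ i * (1 - q ^ (N - 1 - i + 1)) := by
      intro i hi
      rw [mem_range] at hi
      have : q ^ N = q ^ i * q ^ (N - 1 - i + 1) := by rw [← pow_add]; congr 1; omega
      rw [this]; ring
    rw [prod_congr rfl this, prod_mul_distrib, prod_mul_distrib, prod_const, card_range,
      prod_pow_eq_pow_sum, sum_range_id, Nat.choose_two_right,
      prod_range_reflect (fun i => 1 - q ^ (i + 1)) N, qProd]
  have h2 : ∏ i ∈ range N, (q ^ N - q ^ (addLeftEmbedding (N + 1) i)) =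
      q ^ (N ^ 2) * qProd q N := by
    have : ∀ i ∈ range N, q ^ N - q ^ (addLeftEmbedding (N + 1) i) = q ^ N * (1 - q ^ (i + 1)) := by
      intro i _
      rw [addLeftEmbedding_apply, show N + 1 + i = N + (i + 1) by ring, pow_add]
      ring
    rw [prod_congr rfl this, prod_mul_distrib, prod_const, card_range, ← pow_mul, ← sq, qProd]
  rw [h1, h2]
  ring

/-- A finite form of Jacobi's identity for `(q; q)_∞ ^ 3`, obtained by comparing the two evaluations
of `∏ i ≠ N, (q ^ N - q ^ i)`. -/
theorem qProd_sq_eq_sum [IsDomain A] (hq0 : q ≠ 0) (hq : ∀ i : ℕ, 1 - q ^ (i + 1) ≠ 0) (N : ℕ) :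
    qProd q N ^ 2 = ∑ m ∈ range (N + 1),
      (-1) ^ m * (2 * m + 1) * q ^ (m + 1).choose 2 * qBinom q (2 * N + 1) (N - m) := by
  have h := (prod_erase_pow_sub_pow_eq_qProd_sq q N).symm.trans (prod_erase_pow_sub_pow q N)
  -- Pair the terms `k = N - m` and `k = N + 1 + m`: they have opposite signs, and the factors
  -- `N + 1 + m` and `N - m` from the derivative combine to `2 * m + 1`.
  rw [show 2 * N + 2 = (N + 1) + (N + 1) by ring, sum_range_add, ← sum_range_reflect,
    ← sum_add_distrib] at h
  have hc : ((-1) ^ N * q ^ (N.choose 2 + N ^ 2) : A) ≠ 0 :=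
    mul_ne_zero (pow_ne_zero _ (by simp)) (pow_ne_zero _ hq0)
  refine mul_left_cancel₀ hc (h.trans ?_)
  rw [mul_sum]
  refine sum_congr rfl fun m hm => ?_
  have hm : m ≤ N := by rw [mem_range] at hm; omega
  rw [show N + 1 - 1 - m = N - m by omega, qBinom_symm_two_mul_add_one q hq hm]
  have e1 := congrArg (q ^ ·) (choose_two_add_mul_of_le hm)
  simp only [pow_add q] at e1
  have hs : ((-1) ^ (N - m) : A) = (-1) ^ N * (-1) ^ m := by
    rw [← pow_add, show N + m = (N - m) + 2 * m by omega, pow_add, pow_mul]; simp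
  have c1 : ((2 * N + 1 - (N - m) : ℕ) : A) = N + 1 + m := by
    rw [show 2 * N + 1 - (N - m) = N + 1 + m by omega]; push_cast; ring
  have c2 : ((2 * N + 1 - (N + 1 + m) : ℕ) : A) = N - m := by
    rw [show 2 * N + 1 - (N + 1 + m) = N - m by omega]; push_cast [hm]; ring
  rw [hs, c1, c2, pow_add q (N.choose 2)]
  -- For `m = N` the second term has coefficient `N - m = 0`.
  rcases hm.lt_or_eq with hlt | rfl
  · have e2 := congrArg (q ^ ·) (choose_two_add_mul_of_lt hlt)
    simp only [pow_add q] at e2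
    linear_combination (N + 1 + m) * (-1) ^ N * (-1) ^ m * qBinom q (2 * N + 1) (N - m) * e1
      + (N - m) * (-1) ^ (N + 1 + m) * qBinom q (2 * N + 1) (N - m) * e2
  · linear_combination (m + 1 + m) * (-1) ^ m * (-1) ^ m * qBinom q (2 * m + 1) (m - m) * e1

end Finite

/-! ### Euler's products modulo powers of `X`, and Jacobi's identity -/

/-- Reduction modulo `X ^ K`. In the quotient `X` is nilpotent, so infinite products and sums of
power series become finite ones. -/
noncomputable abbrev modXPow (R : Type*) [CommRing R] (K : ℕ) :
    R⟦X⟧ →+* R⟦X⟧ ⧸ Ideal.span {(X : R⟦X⟧) ^ K} := Ideal.Quotient.mk _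

section Trunc
variable {R : Type*} [CommRing R]

lemma modXPow_eq_iff {K : ℕ} {f g : R⟦X⟧} :
    modXPow R K f = modXPow R K g ↔ ∀ n < K, coeff n f = coeff n g := by
  rw [Ideal.Quotient.eq, Ideal.mem_span_singleton, X_pow_dvd_iff]
  simp [sub_eq_zero]

lemma eq_of_modXPow_eq {f g : R⟦X⟧} (h : ∀ K, modXPow R K f = modXPow R K g) : f = g := by
  ext n
  exact modXPow_eq_iff.1 (h (n + 1)) n n.lt_succ_self

lemma modXPow_X_pow {K n : ℕ} (h : K ≤ n) : modXPow R K X ^ n = 0 := by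
  rw [← map_pow, Ideal.Quotient.eq_zero_iff_mem, Ideal.mem_span_singleton]
  exact pow_dvd_pow _ h

lemma qProd_eq_of_pow_eq_zero {A : Type*} [CommRing A] {q : A} {K M N : ℕ} (hq : q ^ K = 0)
    (hM : K ≤ M + 1) (hN : K ≤ N + 1) : qProd q M = qProd q N := by
  have key : ∀ d n, K ≤ n + 1 → qProd q (n + d) = qProd q n := by
    intro d n hn
    induction d with
    | zero => rfl
    | succ d ih =>
      rw [← add_assoc, qProd_succ, ih, pow_eq_zero_of_le (by omega) hq, sub_zero, mul_one]
  rcases le_total M N with h | h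
  · obtain ⟨d, rfl⟩ := Nat.exists_eq_add_of_le h
    exact (key d M hM).symm
  · obtain ⟨d, rfl⟩ := Nat.exists_eq_add_of_le h
    exact key d N hN

lemma isUnit_qProd {A : Type*} [CommRing A] {q : A} (hq : IsNilpotent q) (n : ℕ) :
    IsUnit (qProd q n) := by
  refine IsUnit.prod_iff.2 fun i _ => ?_
  exact IsNilpotent.isUnit_one_sub (hq.pow_succ i)

lemma modXPow_prod_eq_of_subset {g : ℕ → R⟦X⟧} (hg : ∀ i, (X : R⟦X⟧) ^ (i + 1) ∣ g i - 1) {K : ℕ}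
    {s : Finset ℕ} (hs : range K ⊆ s) :
    modXPow R K (∏ i ∈ s, g i) = modXPow R K (∏ i ∈ range K, g i) := by
  rw [map_prod, map_prod]
  refine (prod_subset hs fun i _ hi => ?_).symm
  rw [mem_range, not_lt] at hi
  rw [← map_one (modXPow R K), Ideal.Quotient.eq, Ideal.mem_span_singleton]
  exact (pow_dvd_pow _ (by omega)).trans (hg i)

/-- Euler's pentagonal number theorem, modulo `X ^ K`. -/
theorem modXPow_pentagonalSeries {K N : ℕ} (h : K ≤ N + 1) :
    modXPow R K (pentagonalSeries R) = qProd (modXPow R K X) N := by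
  have hev : ∀ᶠ s : Finset ℕ in Filter.atTop, ∀ n ∈ range K,
      (∏ n ∈ s, (1 - X ^ (n + 1) : R⟦X⟧)).coeff n = (pentagonalSeries R).coeff n :=
    (Filter.eventually_all_finset _).2 fun n _ => coeff_prod_one_sub_X_pow_eventually_eq R n
  obtain ⟨s, h1, h2⟩ := (hev.and (Filter.eventually_ge_atTop (range K))).exists
  have h3 : modXPow R K (pentagonalSeries R) = modXPow R K (∏ n ∈ s, (1 - X ^ (n + 1) : R⟦X⟧)) :=
    modXPow_eq_iff.2 fun n hn => (h1 n (mem_range.2 hn)).symm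
  rw [h3, modXPow_prod_eq_of_subset (fun i => ⟨-1, by ring⟩) h2,
    qProd_eq_of_pow_eq_zero (modXPow_X_pow le_rfl) h (by omega : K ≤ K + 1), ← map_qProd]
  rfl

variable (R) in
/-- Euler's product `f_m = ∏ i ≥ 1, (1 - X ^ (m * i))`, encoded as Mathlib's pentagonal series
evaluated at `X ^ m`; `modXPow_eulerSeries` recovers the product. -/
noncomputable def eulerSeries (m : ℕ) [NeZero m] : R⟦X⟧ :=
  expand m (NeZero.ne m) (pentagonalSeries R)

theorem modXPow_eulerSeries (m : ℕ) [NeZero m] {K N : ℕ} (h : K ≤ N + 1) :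
    modXPow R K (eulerSeries R m) = qProd (modXPow R K X ^ m) N := by
  have h1 := modXPow_pentagonalSeries (R := R) h
  have hm := Nat.pos_of_ne_zero (NeZero.ne m)
  rw [← map_qProd, Ideal.Quotient.eq, Ideal.mem_span_singleton] at h1
  obtain ⟨c, hc⟩ := h1
  rw [← map_pow, ← map_qProd, Ideal.Quotient.eq, Ideal.mem_span_singleton]
  have h2 := congrArg (expand m (NeZero.ne m)) hc
  rw [map_sub, map_mul, map_pow, expand_X, map_qProd, expand_X] at h2
  rw [eulerSeries, h2, ← pow_mul]
  exact Dvd.dvd.mul_right (pow_dvd_pow _ (Nat.le_mul_of_pos_left _ hm)) _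

lemma eulerSeries_one : eulerSeries R 1 = pentagonalSeries R := by
  simp [eulerSeries]

theorem modXPow_eulerSeries_one_pow_three (K : ℕ) :
    modXPow ℤ K (eulerSeries ℤ 1 ^ 3) =
      ∑ m ∈ range K, (-1) ^ m * (2 * m + 1) * modXPow ℤ K X ^ (m + 1).choose 2 := by
  -- With `N = 2 * K`, each Gaussian binomial coefficient that occurs with a nonzero power of `q`
  -- equals the inverse of `f_1` modulo `X ^ K`.
  set N := 2 * K
  set q := modXPow ℤ K X
  have hX : ∀ i : ℕ, (1 - X ^ (i + 1) : ℤ⟦X⟧) ≠ 0 := fun i h => by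
    have := congrArg constantCoeff h
    simp at this
  have h := congrArg (modXPow ℤ K) (qProd_sq_eq_sum (X : ℤ⟦X⟧) X_ne_zero hX N)
  have hb : ∀ n k, modXPow ℤ K (qBinom X n k) = qBinom q n k := by
    intro n
    induction n with
    | zero => intro k; cases k <;> simp [qBinom]
    | succ n ih => intro k; cases k <;> simp [qBinom_succ_succ, ih, q]
  have hq : q ^ K = 0 := modXPow_X_pow le_rfl
  have hP : ∀ n, K ≤ n + 1 → qProd q n = modXPow ℤ K (eulerSeries ℤ 1) := fun n hn => by
    rw [modXPow_eulerSeries 1 hn, pow_one]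
  have hu : IsUnit (modXPow ℤ K (eulerSeries ℤ 1)) := by
    rw [← hP K (by omega)]; exact isUnit_qProd ⟨K, hq⟩ K
  simp only [map_pow, map_qProd, map_sum, map_mul, map_neg, map_one, map_add, hb, map_natCast,
    map_ofNat] at h
  change qProd q N ^ 2 = ∑ m ∈ range (N + 1), (-1) ^ m * (2 * m + 1) * q ^ (m + 1).choose 2 *
    qBinom q (2 * N + 1) (N - m) at h
  rw [hP N (by omega)] at h
  rw [map_pow, pow_succ, h, sum_mul, ← sum_subset (range_subset_range.2 (by omega : K ≤ N + 1))]
  · refine sum_congr rfl fun m hm => ?_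
    rw [mem_range] at hm
    have h1 := qBinom_mul_qProd_mul_qProd q (N + 1 + m) (N - m)
    rw [show N + 1 + m + (N - m) = 2 * N + 1 by omega, hP _ (by omega), hP _ (by omega),
      hP _ (by omega)] at h1
    have h2 : qBinom q (2 * N + 1) (N - m) * modXPow ℤ K (eulerSeries ℤ 1) = 1 :=
      hu.mul_right_cancel (by rw [h1, one_mul])
    linear_combination (-1) ^ m * (2 * m + 1) * q ^ (m + 1).choose 2 * h2
  · intro m _ hm
    rw [mem_range, not_lt] at hm
    have : m ≤ (m + 1).choose 2 := by
      rw [Nat.choose_succ_succ' m 1, Nat.choose_one_right]; omega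
    rw [pow_eq_zero_of_le (hm.trans this) hq]
    ring

/-- **Jacobi's identity** `f_1 ^ 3 = ∑ m, (-1) ^ m * (2 * m + 1) * X ^ (m * (m + 1) / 2)`. -/
theorem coeff_eulerSeries_one_pow_three (n : ℕ) :
    coeff n (eulerSeries ℤ 1 ^ 3) =
      ∑ m ∈ range (n + 1), if n = (m + 1).choose 2 then (-1) ^ m * (2 * m + 1 : ℤ) else 0 := by
  have h : modXPow ℤ (n + 1) (eulerSeries ℤ 1 ^ 3) = modXPow ℤ (n + 1)
      (∑ m ∈ range (n + 1), C ((-1) ^ m * (2 * (m : ℤ) + 1)) * X ^ (m + 1).choose 2) := by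
    have h2 : modXPow ℤ (n + 1) 2 = 2 := map_ofNat _ 2
    rw [modXPow_eulerSeries_one_pow_three]
    simp [h2]
  rw [modXPow_eq_iff.1 h n n.lt_succ_self, map_sum]
  refine sum_congr rfl fun m _ => ?_
  rw [coeff_C_mul, coeff_X_pow]
  simp

end Trunc

/-! ### The partitions counted by `EOBar`, sorted by their largest even part -/

section Comb

/-- A part allowed in a partition whose even parts are at most `2 * k` and whose odd parts exceed
`2 * k`. -/
abbrev IsSplitAt (k i : ℕ) : Prop := (Even i ∧ i ≤ 2 * k) ∨ (Odd i ∧ 2 * k < i)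

open Nat.Partition

/-- Repeat every part of a partition of `n - k` twice and adjoin one part `2 * k` (none if
`k = 0`). -/
def doubleAdjoin (n k : ℕ) (hk : k ≤ n) (p : (n - k).Partition) : (2 * n).Partition where
  parts := 2 • p.parts + if k = 0 then 0 else {2 * k}
  parts_pos := by
    intro i hi
    rw [Multiset.mem_add] at hi
    rcases hi with hi | hi
    · exact p.parts_pos (Multiset.mem_of_mem_nsmul hi)
    · split_ifs at hi with h
      · simp at hi
      · rw [Multiset.mem_singleton] at hi
        omega
  parts_sum := by
    rw [Multiset.sum_add, Multiset.sum_nsmul, p.parts_sum]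
    split_ifs with h
    · simp [h]
    · simp only [Multiset.sum_singleton, smul_eq_mul]
      omega

lemma odd_count_doubleAdjoin {n k : ℕ} (hk : k ≤ n) (p : (n - k).Partition) (a : ℕ) :
    Odd ((doubleAdjoin n k hk p).parts.count a) ↔ k ≠ 0 ∧ a = 2 * k := by
  rw [doubleAdjoin, Multiset.count_add, Multiset.count_nsmul]
  split_ifs with h
  · simp [h]
  · rw [Multiset.count_singleton]
    split_ifs with h2
    · simp [h, h2]
    · simp [h2]

lemma mem_doubleAdjoin {n k : ℕ} (hk : k ≤ n) (p : (n - k).Partition) (a : ℕ) :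
    a ∈ (doubleAdjoin n k hk p).parts ↔ a ∈ p.parts ∨ k ≠ 0 ∧ a = 2 * k := by
  rw [doubleAdjoin, Multiset.mem_add, Multiset.mem_nsmul]
  split_ifs with h <;> simp [h]

lemma isEOBar_doubleAdjoin {n k : ℕ} (hk : k ≤ n) {p : (n - k).Partition}
    (hp : ∀ i ∈ p.parts, IsSplitAt k i) : IsEOBar (doubleAdjoin n k hk p) := by
  have he : ∀ a ∈ (doubleAdjoin n k hk p).parts, Even a → a ≤ 2 * k := by
    intro a ha hae
    rcases (mem_doubleAdjoin hk p a).1 ha with h | ⟨-, rfl⟩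
    · rcases hp a h with h | h
      · exact h.2
      · exact absurd hae (Nat.not_even_iff_odd.2 h.1)
    · exact le_rfl
  refine ⟨fun a ha b hb hae hbo => (he a ha hae).trans_lt ?_, fun a ha => ?_⟩
  · rcases (mem_doubleAdjoin hk p b).1 hb with h | ⟨-, rfl⟩
    · rcases hp b h with h | h
      · exact absurd h.1 (Nat.not_even_iff_odd.2 hbo)
      · exact h.2
    · exact absurd hbo (by simp)
  · rw [odd_count_doubleAdjoin]
    constructor
    · rintro ⟨hk0, rfl⟩
      exact ⟨ha, even_two_mul k, he⟩
    · rintro ⟨-, hae, hmax⟩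
      have h1 := he a ha hae
      have h2 := (doubleAdjoin n k hk p).parts_pos ha
      have hk0 : k ≠ 0 := by omega
      exact ⟨hk0, h1.antisymm (hmax _ ((mem_doubleAdjoin hk p _).2 (Or.inr ⟨hk0, rfl⟩))
        (even_two_mul k))⟩

/-- Here `2 * k` is the largest even part, or `k = 0` if there is none; the remaining multiplicities
are even, so they can be halved. -/
lemma exists_eq_doubleAdjoin {n : ℕ} {r : (2 * n).Partition} (hr : IsEOBar r) :
    ∃ k, ∃ hk : k ≤ n, ∃ p : (n - k).Partition,
      (∀ i ∈ p.parts, IsSplitAt k i) ∧ doubleAdjoin n k hk p = r := by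
  obtain ⟨hEO, hodd⟩ := hr
  by_cases hex : ∃ a ∈ r.parts, Even a
  · obtain ⟨a, ha, hmax⟩ := (r.parts.toFinset.filter Even).exists_max_image id
      (by obtain ⟨a, h1, h2⟩ := hex; exact ⟨a, by simp [h1, h2]⟩)
    simp only [mem_filter, Multiset.mem_toFinset, id, and_imp] at ha hmax
    obtain ⟨har, hae⟩ := ha
    obtain ⟨k, rfl⟩ := hae.two_dvd
    have hk0 : k ≠ 0 := by have := r.parts_pos har; omega
    have hcount : ∀ b ∈ r.parts.erase (2 * k), 2 ∣ (r.parts.erase (2 * k)).count b := by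
      intro b hb
      have hbr := Multiset.mem_of_mem_erase hb
      by_cases hbk : b = 2 * k
      · subst hbk
        have : Odd (r.parts.count (2 * k)) := (hodd _ har).2 ⟨har, hae, hmax⟩
        rw [Multiset.count_erase_self]
        obtain ⟨c, hc⟩ := this
        exact ⟨c, by omega⟩
      · rw [Multiset.count_erase_of_ne hbk, ← even_iff_two_dvd, ← Nat.not_odd_iff_even, hodd b hbr]
        rintro ⟨-, hbe, hb'⟩
        exact hbk ((hmax b hbr hbe).antisymm (hb' _ har hae))
    obtain ⟨u, hu⟩ := Multiset.exists_smul_of_dvd_count _ hcount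
    have hcons := Multiset.cons_erase har
    have hsum := r.parts_sum
    rw [← hcons, hu, Multiset.sum_cons, Multiset.sum_nsmul, smul_eq_mul] at hsum
    have hmem : ∀ i ∈ u, i ∈ r.parts := fun i hi =>
      Multiset.mem_of_mem_erase (hu ▸ Multiset.mem_nsmul.2 ⟨two_ne_zero, hi⟩)
    refine ⟨k, by omega, ⟨u, fun hi => r.parts_pos (hmem _ hi), by omega⟩, fun i hi => ?_, ?_⟩
    · rcases Nat.even_or_odd i with h | h
      · exact Or.inl ⟨h, hmax i (hmem i hi) h⟩
      · exact Or.inr ⟨h, hEO _ har i (hmem i hi) hae h⟩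
    · ext1
      change 2 • u + (if k = 0 then 0 else {2 * k}) = r.parts
      rw [if_neg hk0, ← hu, add_comm, Multiset.singleton_add, hcons]
  · push Not at hex
    have hcount : ∀ b ∈ r.parts, 2 ∣ r.parts.count b := by
      intro b hb
      rw [← even_iff_two_dvd, ← Nat.not_odd_iff_even, hodd b hb]
      exact fun h => absurd h.2.1 (hex b hb)
    obtain ⟨u, hu⟩ := Multiset.exists_smul_of_dvd_count _ hcount
    have hsum := r.parts_sum
    rw [hu, Multiset.sum_nsmul, smul_eq_mul] at hsum
    have hmem : ∀ i ∈ u, i ∈ r.parts := fun i hi =>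
      hu ▸ Multiset.mem_nsmul.2 ⟨two_ne_zero, hi⟩
    refine ⟨0, n.zero_le, ⟨u, fun hi => r.parts_pos (hmem _ hi), by omega⟩, fun i hi => ?_, ?_⟩
    · exact Or.inr ⟨Nat.not_even_iff_odd.1 (hex i (hmem i hi)), r.parts_pos (hmem i hi)⟩
    · ext1
      simp [doubleAdjoin, hu]

lemma doubleAdjoin_injective {n k k' : ℕ} {hk : k ≤ n} {hk' : k' ≤ n} {p : (n - k).Partition}
    {p' : (n - k').Partition} (h : doubleAdjoin n k hk p = doubleAdjoin n k' hk' p') :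
    (⟨k, p⟩ : Σ k, (n - k).Partition) = ⟨k', p'⟩ := by
  have hkk : k = k' := by
    have h1 := odd_count_doubleAdjoin hk p (2 * k)
    have h2 := odd_count_doubleAdjoin hk p (2 * k')
    rw [h, odd_count_doubleAdjoin] at h1 h2
    omega
  subst hkk
  have h3 := congrArg Nat.Partition.parts h
  simp only [doubleAdjoin, add_left_inj] at h3
  congr 1
  ext a
  have h4 := congrArg (Multiset.count a) h3
  rw [Multiset.count_nsmul, Multiset.count_nsmul] at h4
  omega

theorem EOBar_two_mul (n : ℕ) :
    EOBar (2 * n) = ∑ k ∈ range (n + 1), #(restricted (n - k) (IsSplitAt k)) := by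
  rw [EOBar, ← card_sigma]
  symm
  refine card_bij (fun x hx => doubleAdjoin n x.1
    (Nat.lt_succ_iff.1 (mem_range.1 (mem_sigma.1 hx).1)) x.2) ?_ ?_ ?_
  · intro x hx
    simp only [mem_sigma, restricted, mem_filter, mem_univ, true_and] at hx ⊢
    exact isEOBar_doubleAdjoin _ hx.2
  · intro x _ y _ h
    exact doubleAdjoin_injective h
  · intro r hr
    obtain ⟨k, hk, p, hp, rfl⟩ := exists_eq_doubleAdjoin (mem_filter.1 hr).2
    exact ⟨⟨k, p⟩, mem_sigma.2 ⟨mem_range.2 (Nat.lt_succ_of_le hk),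
      mem_filter.2 ⟨mem_univ _, hp⟩⟩, rfl⟩

end Comb

/-! ### The generating function of `EOBar (2 * n)` -/

section QSeries

/-- The case `a = z = q`, with base `q ^ 2`, of the infinite `q`-binomial theorem
`∑ k, z ^ k * (a)_k / (q ^ 2)_k = (a * z)_∞ / (z)_∞`, for nilpotent `q`. The hypotheses say that
`t k = (q; q ^ 2)_k / (q ^ 2; q ^ 2)_k`. -/
theorem sum_pow_mul_mul_prod_one_sub {A : Type*} [CommRing A] {q : A} {K : ℕ} (hq : q ^ K = 0)
    {t : ℕ → A} (h0 : t 0 = 1)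
    (ht : ∀ k < K, t (k + 1) * (1 - q ^ (2 * k + 2)) = t k * (1 - q ^ (2 * k + 1)))
    {N : ℕ} (hN : K ≤ N) :
    (∑ k ∈ range K, q ^ k * t k) * ∏ j ∈ range N, (1 - q ^ (2 * j + 1)) =
      ∏ j ∈ range N, (1 - q ^ (2 * j + 2)) := by
  have hz : ∀ m, K ≤ m → q ^ m = 0 := fun m hm => pow_eq_zero_of_le hm hq
  let F : ℕ → A := fun j => ∑ k ∈ range K, q ^ (k * (2 * j + 1)) * t k
  -- The functional equation `(1 - z) F(z) = (1 - q * z) F(q ^ 2 * z)` at `z = q ^ (2 * j + 1)`.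
  -- Iterating it moves `z` up to a power of `q` that vanishes.
  have hF : ∀ j, (1 - q ^ (2 * j + 1)) * F j = (1 - q ^ (2 * j + 2)) * F (j + 1) := by
    intro j
    have hpart : ∀ M ≤ K, (1 - q ^ (2 * j + 1)) * (∑ k ∈ range M, q ^ (k * (2 * j + 1)) * t k) -
        (1 - q ^ (2 * j + 2)) * (∑ k ∈ range M, q ^ (k * (2 * (j + 1) + 1)) * t k) +
        q ^ (M * (2 * j + 1)) * t M * (1 - q ^ (2 * M)) = 0 := by
      intro M hM
      induction M with
      | zero => simp
      | succ M ih =>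
        rw [sum_range_succ, sum_range_succ]
        have h1 := ht M (by omega)
        have h2 := ih (by omega)
        rw [show 2 * (M + 1) = 2 * M + 2 by ring]
        linear_combination h2 + q ^ ((M + 1) * (2 * j + 1)) * h1
    have h := hpart K le_rfl
    rw [hz (K * (2 * j + 1)) (Nat.le_mul_of_pos_right _ (by omega)), zero_mul, zero_mul,
      add_zero, sub_eq_zero] at h
    exact h
  have hind : ∀ M, F 0 * ∏ j ∈ range M, (1 - q ^ (2 * j + 1)) =
      F M * ∏ j ∈ range M, (1 - q ^ (2 * j + 2)) := by
    intro M
    induction M with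
    | zero => simp
    | succ M ih =>
      rw [prod_range_succ, prod_range_succ, ← mul_assoc, ih]
      linear_combination (∏ j ∈ range M, (1 - q ^ (2 * j + 2))) * hF M
  have hFN : K ≠ 0 → F N = 1 := by
    intro hK
    obtain ⟨L, rfl⟩ := Nat.exists_eq_succ_of_ne_zero hK
    change ∑ k ∈ range (L + 1), _ = _
    rw [sum_range_succ', sum_eq_zero]
    · simp [h0]
    · intro k _
      rw [hz _ _, zero_mul]
      nlinarith
  rcases eq_or_ne K 0 with rfl | hK
  · have : Subsingleton A := subsingleton_of_zero_eq_one (by simpa using hq.symm)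
    exact Subsingleton.elim _ _
  · have := hind N
    rw [hFN hK, one_mul] at this
    simpa [F] using this

lemma prod_range_two_mul {M : Type*} [CommMonoid M] (a : ℕ → M) (N : ℕ) :
    ∏ i ∈ range (2 * N), a i = ∏ j ∈ range N, (a (2 * j) * a (2 * j + 1)) := by
  induction N with
  | zero => rfl
  | succ N ih =>
    rw [show 2 * (N + 1) = 2 * N + 1 + 1 by ring, prod_range_succ, prod_range_succ, ih,
      prod_range_succ, mul_assoc]

lemma qProd_two_mul {A : Type*} [CommRing A] (q : A) (N : ℕ) :
    qProd q (2 * N) = (∏ j ∈ range N, (1 - q ^ (2 * j + 1))) * qProd (q ^ 2) N := by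
  rw [qProd, prod_range_two_mul, prod_mul_distrib, qProd]
  simp only [← pow_mul]
  rfl

variable (R : Type*) [CommRing R]

/-- Modulo `X ^ K`, the generating function of the partitions with parts satisfying `p` is the
inverse of `∏ (1 - X ^ i)` over the `i` satisfying `p`. -/
theorem modXPow_mk_card_restricted (p : ℕ → Prop) [DecidablePred p] {K N : ℕ} (h : K ≤ N) :
    modXPow R K (PowerSeries.mk fun n => (#(Nat.Partition.restricted n p) : R)) *
      ∏ i ∈ range N, (if p (i + 1) then 1 - modXPow R K X ^ (i + 1) else 1) = 1 := by
  let : TopologicalSpace R := ⊥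
  have : DiscreteTopology R := ⟨rfl⟩
  open WithPiTopology in
  have hp := Nat.Partition.hasProd_powerSeriesMk_card_restricted R p
  rw [HasProd, PowerSeries.WithPiTopology.tendsto_iff_coeff_tendsto] at hp
  simp only [SummationFilter.unconditional_filter, nhds_discrete, Filter.tendsto_pure] at hp
  obtain ⟨s, h1, h2⟩ := (((Filter.eventually_all_finset (range K)).2 fun n _ => hp n).and
    (Filter.eventually_ge_atTop (range N))).exists
  have h3 := modXPow_eq_iff.2 fun n hn => h1 n (mem_range.2 hn)
  have h4 : ∏ i ∈ range N, (if p (i + 1) then 1 - modXPow R K X ^ (i + 1) else 1) =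
      modXPow R K (∏ i ∈ s, (if p (i + 1) then 1 - X ^ (i + 1) else 1)) := by
    have hd : ∀ i, (X : R⟦X⟧) ^ (i + 1) ∣ (if p (i + 1) then 1 - X ^ (i + 1) else 1) - 1 := by
      intro i
      split_ifs
      · exact ⟨-1, by ring⟩
      · simp
    rw [modXPow_prod_eq_of_subset hd ((range_subset_range.2 h).trans h2),
      ← modXPow_prod_eq_of_subset hd (range_subset_range.2 h), map_prod]
    refine prod_congr rfl fun i _ => ?_
    split_ifs <;> simp
  rw [← h3, h4, ← map_mul, ← prod_mul_distrib, prod_eq_one, map_one]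
  intro i _
  split_ifs
  · simp_rw [pow_mul]
    exact tsum_pow_mul_one_sub_of_constantCoeff_eq_zero (by simp)
  · simp

/-- The generating function of `n ↦ EOBar (2 * n)`, with coefficients in `R`. -/
noncomputable def EOBarSeries : R⟦X⟧ := PowerSeries.mk fun n => (EOBar (2 * n) : R)

lemma modXPow_EOBarSeries (K : ℕ) : modXPow R K (EOBarSeries R) =
    ∑ k ∈ range K, modXPow R K X ^ k * modXPow R K
      (PowerSeries.mk fun n => (#(Nat.Partition.restricted n (IsSplitAt k)) : R)) := by
  simp_rw [← map_pow, ← map_mul, ← map_sum]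
  refine modXPow_eq_iff.2 fun n hn => ?_
  rw [EOBarSeries, coeff_mk, EOBar_two_mul, map_sum, Nat.cast_sum,
    ← sum_subset (range_subset_range.2 hn)]
  · refine sum_congr rfl fun k hk => ?_
    rw [coeff_X_pow_mul', if_pos (by rw [mem_range] at hk; omega), coeff_mk]
  · intro k _ hk
    rw [coeff_X_pow_mul', if_neg (by rw [mem_range] at hk; omega)]

/-- Andrews' product formula `∑ EOBar (2 * n) X ^ n = f_2 ^ 3 / f_1 ^ 2`. -/
theorem EOBarSeries_mul_eulerSeries_one_sq :
    EOBarSeries R * eulerSeries R 1 ^ 2 = eulerSeries R 2 ^ 3 := by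
  refine eq_of_modXPow_eq fun K => ?_
  set q := modXPow R K X with hqdef
  have hq : q ^ K = 0 := modXPow_X_pow le_rfl
  set O := ∏ j ∈ range K, (1 - q ^ (2 * j + 1)) with hO
  have h1 : modXPow R K (eulerSeries R 1) = O * qProd (q ^ 2) K := by
    rw [modXPow_eulerSeries 1 (by omega : K ≤ 2 * K + 1), pow_one, qProd_two_mul]
  have h2 : modXPow R K (eulerSeries R 2) = qProd (q ^ 2) K := modXPow_eulerSeries 2 (by omega)
  set r : ℕ → R⟦X⟧ ⧸ Ideal.span {(X : R⟦X⟧) ^ K} := fun k => modXPow R K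
    (PowerSeries.mk fun n => (#(Nat.Partition.restricted n (IsSplitAt k)) : R)) with hr
  -- `r k` is the inverse of `(q ^ 2; q ^ 2)_k * ∏ k ≤ j, (1 - q ^ (2 * j + 1))`.
  have ht : ∀ k ≤ K, r k * O * qProd (q ^ 2) k = ∏ j ∈ range k, (1 - q ^ (2 * j + 1)) := by
    intro k hk
    have h := modXPow_mk_card_restricted R (IsSplitAt k) (by omega : K ≤ 2 * K)
    rw [prod_range_two_mul, prod_mul_distrib] at h
    have e1 : ∀ j, IsSplitAt k (2 * j + 1) ↔ ¬ j < k := by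
      intro j; simp [IsSplitAt]
    have e2 : ∀ j, IsSplitAt k (2 * j + 1 + 1) ↔ j < k := by
      intro j; simp [IsSplitAt, Nat.even_add_one, parity_simps]; omega
    simp only [e1, e2] at h
    have hf : (range K).filter (· < k) = range k := by ext j; simp; omega
    have e3 : ∏ j ∈ range K, (if j < k then 1 - q ^ (2 * j + 1 + 1) else 1) = qProd (q ^ 2) k := by
      rw [← prod_filter, hf, qProd]
      simp only [← pow_mul]
      rfl
    have e4 : O = (∏ j ∈ range k, (1 - q ^ (2 * j + 1))) *
        ∏ j ∈ range K, (if ¬ j < k then 1 - q ^ (2 * j + 1) else 1) := by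
      rw [hO, ← prod_filter_mul_prod_filter_not (range K) (· < k), hf, ← prod_filter]
    rw [e3] at h
    rw [e4]
    linear_combination (∏ j ∈ range k, (1 - q ^ (2 * j + 1))) * h
  have hsum := sum_pow_mul_mul_prod_one_sub hq (t := fun k => r k * O)
    (by simpa using ht 0 K.zero_le) (fun k hk => ?_) le_rfl
  · have h3 := modXPow_EOBarSeries R K
    simp only [← mul_assoc] at hsum
    rw [← sum_mul, ← h3] at hsum
    have h5 : ∏ j ∈ range K, (1 - q ^ (2 * j + 2)) = qProd (q ^ 2) K := by
      rw [qProd]; simp only [← pow_mul]; rfl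
    rw [h5] at hsum
    rw [map_mul, map_pow, map_pow, h1, h2]
    linear_combination qProd (q ^ 2) K ^ 2 * hsum
  · have hu : IsUnit (qProd (q ^ 2) k) :=
      isUnit_qProd (IsNilpotent.pow_of_pos ⟨K, hq⟩ two_ne_zero) k
    refine hu.mul_right_cancel ?_
    have a1 := ht k hk.le
    have a2 := ht (k + 1) hk
    rw [qProd_succ, prod_range_succ, ← pow_mul, show 2 * (k + 1) = 2 * k + 2 by ring] at a2
    linear_combination a2 - (1 - q ^ (2 * k + 1)) * a1

end QSeries

/-! ### Divisibility by five -/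

section ModFive

lemma map_eulerSeries {R S : Type*} [CommRing R] [CommRing S] (f : R →+* S) (m : ℕ) [NeZero m] :
    PowerSeries.map f (eulerSeries R m) = eulerSeries S m := by
  rw [eulerSeries, map_expand, eulerSeries]
  congr 1
  ext n
  rw [coeff_map]
  by_cases h : n ∈ Set.range pentagonal
  · obtain ⟨k, rfl⟩ := h
    rw [coeff_pentagonalSeries_pentagonal, coeff_pentagonalSeries_pentagonal, map_intCast]
  · rw [coeff_pentagonalSeries_eq_zero R h, coeff_pentagonalSeries_eq_zero S h, map_zero]

lemma eulerSeries_eq_expand (R : Type*) [CommRing R] (m : ℕ) [NeZero m] :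
    eulerSeries R m = expand m (NeZero.ne m) (eulerSeries R 1) := by
  rw [eulerSeries_one, eulerSeries]

lemma eulerSeries_one_pow_five : eulerSeries (ZMod 5) 1 ^ 5 = eulerSeries (ZMod 5) 5 := by
  refine eq_of_modXPow_eq fun K => ?_
  rw [map_pow, modXPow_eulerSeries 1 K.le_succ, modXPow_eulerSeries 5 K.le_succ, pow_one, qProd,
    qProd, ← prod_pow]
  refine prod_congr rfl fun i _ => ?_
  have h5 : (5 : (ZMod 5)⟦X⟧ ⧸ Ideal.span {(X : (ZMod 5)⟦X⟧) ^ K}) = 0 := by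
    have h : (5 : (ZMod 5)⟦X⟧) = 0 := by
      rw [← map_ofNat (C (R := ZMod 5)) 5, show (OfNat.ofNat 5 : ZMod 5) = 0 from rfl, map_zero]
    rw [← map_ofNat (modXPow (ZMod 5) K) 5, h, map_zero]
  set x := modXPow (ZMod 5) K X ^ (i + 1) with hx
  rw [pow_right_comm, ← hx]
  linear_combination (-x + 2 * x ^ 2 - 2 * x ^ 3 + x ^ 4) * h5

/-- By Jacobi's identity, `f_1 ^ 3` modulo `p` is supported on the triangular numbers
`(y ^ 2 - 1) / 8` with `y` odd and prime to `p`. -/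
lemma exists_of_coeff_eulerSeries_one_pow_three_ne_zero {p : ℕ} {n : ℕ}
    (h : coeff n (eulerSeries (ZMod p) 1 ^ 3) ≠ 0) : ∃ y : ℕ, 8 * n + 1 = y ^ 2 ∧ ¬ p ∣ y := by
  rw [← map_eulerSeries (Int.castRingHom (ZMod p)), ← map_pow, coeff_map,
    coeff_eulerSeries_one_pow_three, map_sum] at h
  obtain ⟨m, -, hm⟩ := exists_ne_zero_of_sum_ne_zero h
  split_ifs at hm with hn
  · refine ⟨2 * m + 1, ?_, fun hp => hm ?_⟩
    · have := two_mul_cast_choose_two (m + 1)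
      rw [← hn] at this
      push_cast at this
      zify
      linear_combination 4 * this
    · obtain ⟨c, hc⟩ := hp
      have : (2 * m + 1 : ℤ) = p * c := by exact_mod_cast hc
      rw [this]
      simp
  · simp at hm

lemma coeff_expand_ne_zero {R : Type*} [CommRing R] {m : ℕ} (hm : m ≠ 0) {f : R⟦X⟧} {n : ℕ}
    (h : coeff n (expand m hm f) ≠ 0) : ∃ c, n = m * c ∧ coeff c f ≠ 0 := by
  by_cases hd : m ∣ n
  · obtain ⟨c, rfl⟩ := hd
    exact ⟨c, rfl, by rwa [coeff_expand_mul] at h⟩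
  · exact absurd (coeff_expand_of_not_dvd m hm f hd) h

/-- Multiplication by a unit power series in `X ^ m` does not affect whether the coefficients in a
residue class modulo `m` vanish. -/
lemma coeff_eq_zero_of_mul_expand {R : Type*} [CommRing R] {m : ℕ} (hm : m ≠ 0) {f g h : R⟦X⟧}
    (hg : constantCoeff g = 1) (hfg : f * expand m hm g = h) {r : ℕ} (hrm : r < m)
    (hr : ∀ n, coeff (m * n + r) h = 0) (n : ℕ) : coeff (m * n + r) f = 0 := by
  induction n using Nat.strong_induction_on with
  | _ n ih =>
    have h1 := hr n
    rw [← hfg, coeff_mul, sum_eq_single (m * n + r, 0)] at h1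
    · simpa [hg] using h1
    · rintro ⟨a, b⟩ hab hne
      rw [HasAntidiagonal.mem_antidiagonal] at hab
      dsimp only at hab ⊢
      by_contra hcon
      obtain ⟨c, rfl, -⟩ := coeff_expand_ne_zero hm (right_ne_zero_of_mul hcon)
      have hcn : c ≤ n := by
        by_contra hlt
        have := Nat.mul_le_mul_left m (not_le.1 hlt)
        rw [Nat.mul_succ] at this
        omega
      obtain ⟨d, rfl⟩ := Nat.exists_eq_add_of_le hcn
      obtain rfl : a = m * d + r := by rw [mul_add] at hab; omega
      refine left_ne_zero_of_mul hcon (ih d ?_)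
      have hc0 : c ≠ 0 := by
        rintro rfl
        simp at hne
      omega
    · simp

theorem coeff_EOBarSeries_zmod_five (n : ℕ) : coeff (5 * n + 4) (EOBarSeries (ZMod 5)) = 0 := by
  have hG : EOBarSeries (ZMod 5) * expand 5 (NeZero.ne 5) (eulerSeries (ZMod 5) 1) =
      eulerSeries (ZMod 5) 1 ^ 3 * expand 2 two_ne_zero (eulerSeries (ZMod 5) 1 ^ 3) := by
    rw [map_pow, ← eulerSeries_eq_expand _ 5, ← eulerSeries_eq_expand _ 2,
      ← eulerSeries_one_pow_five]
    linear_combination eulerSeries (ZMod 5) 1 ^ 3 * EOBarSeries_mul_eulerSeries_one_sq (ZMod 5)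
  have h1 : constantCoeff (eulerSeries (ZMod 5) 1) = 1 := by
    rw [eulerSeries_one, ← coeff_zero_eq_constantCoeff_apply]
    simpa [pentagonal_def] using coeff_pentagonalSeries_pentagonal (ZMod 5) 0
  refine coeff_eq_zero_of_mul_expand _ h1 hG (by norm_num) (fun n => ?_) n
  rw [coeff_mul]
  refine sum_eq_zero fun ⟨a, b⟩ hab => ?_
  rw [HasAntidiagonal.mem_antidiagonal] at hab
  dsimp only at hab ⊢
  by_contra hcon
  obtain ⟨y, hy, hy5⟩ :=
    exists_of_coeff_eulerSeries_one_pow_three_ne_zero (left_ne_zero_of_mul hcon)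
  obtain ⟨c, rfl, hc⟩ := coeff_expand_ne_zero _ (right_ne_zero_of_mul hcon)
  obtain ⟨z, hz, -⟩ := exists_of_coeff_eulerSeries_one_pow_three_ne_zero hc
  have h5 : ((y ^ 2 + 2 * z ^ 2 : ℕ) : ZMod 5) = 0 := by
    rw [ZMod.natCast_eq_zero_iff]
    exact ⟨8 * n + 7, by rw [← hy, ← hz]; linarith⟩
  have key : ∀ y z : ZMod 5, y ^ 2 + 2 * z ^ 2 = 0 → y = 0 := by decide
  refine hy5 ((ZMod.natCast_eq_zero_iff _ _).1 (key y z ?_))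
  exact_mod_cast h5

end ModFive

/-! ### Representations by `x ^ 2 + 6 * y ^ 2` and by divisors -/

section Parity

lemma even_card_of_involution {α : Type*} [DecidableEq α] {s : Finset α} (g : α → α)
    (hmem : ∀ a ∈ s, g a ∈ s) (hne : ∀ a ∈ s, g a ≠ a) (hinv : ∀ a ∈ s, g (g a) = a) :
    Even #s := by
  have h : ∑ _a ∈ s, (1 : ZMod 2) = 0 :=
    sum_involution (fun a _ => g a) (fun _ _ => by decide) (fun a ha _ => hne a ha) hmem hinv
  rw [sum_const, nsmul_one] at h
  exact (ZMod.natCast_eq_zero_iff_even).1 h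

/-- The involution `d ↦ n / d` pairs up the divisors that are not a square root of `n`. -/
lemma odd_card_divisors_iff (n : ℕ) : Odd #n.divisors ↔ ∃ y, 0 < y ∧ n = y ^ 2 := by
  have h1 : Even #{d ∈ n.divisors | ¬ n = d ^ 2} := by
    refine even_card_of_involution (fun d => n / d) ?_ ?_ ?_
    · intro d hd
      simp only [mem_filter, Nat.mem_divisors] at hd ⊢
      obtain ⟨⟨⟨e, rfl⟩, hn⟩, hsq⟩ := hd
      rw [Nat.mul_div_cancel_left _ (Nat.pos_of_ne_zero (left_ne_zero_of_mul hn))]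
      exact ⟨⟨⟨d, mul_comm _ _⟩, hn⟩, fun h => hsq (by
        have : d = e := Nat.eq_of_mul_eq_mul_right (Nat.pos_of_ne_zero (right_ne_zero_of_mul hn))
          (by rw [h, sq])
        rw [this, sq])⟩
    · intro d hd
      simp only [mem_filter, Nat.mem_divisors] at hd
      obtain ⟨⟨⟨e, rfl⟩, hn⟩, hsq⟩ := hd
      rw [Nat.mul_div_cancel_left _ (Nat.pos_of_ne_zero (left_ne_zero_of_mul hn))]
      rintro rfl
      exact hsq (sq _).symm
    · intro d hd
      simp only [mem_filter, Nat.mem_divisors] at hd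
      exact Nat.div_div_self hd.1.1 hd.1.2
  rw [← card_filter_add_card_filter_not (s := n.divisors) (fun d => n = d ^ 2), Nat.odd_add']
  simp only [h1, ← Nat.not_even_iff_odd, not_true_eq_false, false_iff]
  constructor
  · intro h
    have : (n.divisors.filter (fun d => n = d ^ 2)).Nonempty := by
      rw [nonempty_iff_ne_empty]
      intro h0
      simp [h0] at h
    obtain ⟨d, hd⟩ := this
    rw [mem_filter] at hd
    exact ⟨d, Nat.pos_of_mem_divisors hd.1, hd.2⟩
  · rintro ⟨y, hy, rfl⟩
    have : (y ^ 2).divisors.filter (fun d => y ^ 2 = d ^ 2) = {y} := by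
      ext d
      simp only [mem_filter, Nat.mem_divisors, mem_singleton]
      constructor
      · rintro ⟨-, h⟩
        exact (Nat.pow_left_injective two_ne_zero h).symm
      · rintro rfl
        exact ⟨⟨dvd_pow_self _ two_ne_zero, (pow_pos hy 2).ne'⟩, rfl⟩
    rw [this, card_singleton]
    decide

/-- In `ℤ[√-6]` the prime `5` splits as `P * P'`, and `P ^ 2` is generated by `1 + 2 * √-6` or its
conjugate. If `x ^ 2 + 6 * y ^ 2` is divisible by `5` exactly once, then multiplication of
`x + y * √-6` by `(1 ± 2 * √-6) / 5`, for exactly one choice of the sign, exchanges the factors `P`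
and `P'`. This is that map on the absolute values of the coordinates. -/
def swapAboveFive (p : ℕ × ℕ) : ℕ × ℕ :=
  if 5 ∣ 2 * p.1 + p.2 then
    (((p.1 : ℤ) - 12 * p.2).natAbs / 5, ((p.2 : ℤ) + 2 * p.1).natAbs / 5)
  else (((p.1 : ℤ) + 12 * p.2).natAbs / 5, ((p.2 : ℤ) - 2 * p.1).natAbs / 5)

/-- The sign `e` turns both branches of `swapAboveFive` into one formula, up to absolute values. -/
lemma swapAboveFive_spec {x y : ℕ} (hxy : (5 : ℤ) ∣ 2 * x + y ∨ (5 : ℤ) ∣ 2 * x - y) :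
    ∃ e : ℤ, (e = 1 ∨ e = -1) ∧ 5 ∣ 2 * x + e * y ∧
      (5 * ((swapAboveFive (x, y)).1 : ℤ) = x - 12 * (e * y) ∨
        5 * ((swapAboveFive (x, y)).1 : ℤ) = -(x - 12 * (e * y))) ∧
      (5 * ((swapAboveFive (x, y)).2 : ℤ) = e * y + 2 * x ∨
        5 * ((swapAboveFive (x, y)).2 : ℤ) = -(e * y + 2 * x)) := by
  unfold swapAboveFive
  split_ifs with h
  · exact ⟨1, Or.inl rfl, by dsimp only at *; omega, by dsimp only at *; omega,
      by dsimp only at *; omega⟩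
  · exact ⟨-1, Or.inr rfl, by dsimp only at *; omega, by dsimp only at *; omega,
      by dsimp only at *; omega⟩

/-- The formula of `swapAboveFive_spec` determines the value, since only one sign `e` is
possible. -/
lemma swapAboveFive_eq {x y x' y' : ℕ} (hx : ¬ 5 ∣ x) {e : ℤ} (he : e = 1 ∨ e = -1)
    (h : 5 ∣ 2 * x + e * y)
    (hx' : 5 * (x' : ℤ) = x - 12 * (e * y) ∨ 5 * (x' : ℤ) = -(x - 12 * (e * y)))
    (hy' : 5 * (y' : ℤ) = e * y + 2 * x ∨ 5 * (y' : ℤ) = -(e * y + 2 * x)) :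
    swapAboveFive (x, y) = (x', y') := by
  unfold swapAboveFive
  rcases he with rfl | rfl
  · rw [if_pos (by dsimp only; omega)]
    ext <;> dsimp only <;> omega
  · rw [if_neg (by dsimp only; omega)]
    ext <;> dsimp only <;> omega

lemma swapAboveFive_conj {x y : ℕ} (hx : ¬ 5 ∣ (swapAboveFive (x, y)).1)
    (hxy : (5 : ℤ) ∣ 2 * x + y ∨ (5 : ℤ) ∣ 2 * x - y) :
    swapAboveFive (swapAboveFive (x, y)) = (x, y) := by
  obtain ⟨e, he, -, h1, h2⟩ := swapAboveFive_spec hxy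
  generalize swapAboveFive (x, y) = p at *
  obtain ⟨x', y'⟩ := p
  dsimp only at *
  have key : ∃ e' : ℤ, (e' = 1 ∨ e' = -1) ∧ 5 ∣ 2 * x' + e' * y' ∧
      (5 * (x : ℤ) = x' - 12 * (e' * y') ∨ 5 * (x : ℤ) = -(x' - 12 * (e' * y'))) ∧
      (5 * (y : ℤ) = e' * y' + 2 * x' ∨ 5 * (y : ℤ) = -(e' * y' + 2 * x')) := by
    rcases h1 with h1 | h1 <;> rcases h2 with h2 | h2
    · exact ⟨-1, by rcases he with rfl | rfl <;> omega⟩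
    · exact ⟨1, by rcases he with rfl | rfl <;> omega⟩
    · exact ⟨1, by rcases he with rfl | rfl <;> omega⟩
    · exact ⟨-1, by rcases he with rfl | rfl <;> omega⟩
  obtain ⟨e', he', h, h1', h2'⟩ := key
  exact swapAboveFive_eq hx he' h h1' h2'

/-- A fixed point would satisfy `x = 2 * y` or `x = 3 * y`. -/
lemma swapAboveFive_ne {x y : ℕ} (hx2 : ¬ 2 ∣ x) (hx3 : ¬ 3 ∣ x)
    (hxy : (5 : ℤ) ∣ 2 * x + y ∨ (5 : ℤ) ∣ 2 * x - y) :
    swapAboveFive (x, y) ≠ (x, y) := by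
  obtain ⟨e, he, -, h1, h2⟩ := swapAboveFive_spec hxy
  intro h
  rw [h] at h1 h2
  rcases he with rfl | rfl <;> dsimp only at * <;> omega

lemma swapAboveFive_norm {x y : ℕ} (hxy : (5 : ℤ) ∣ 2 * x + y ∨ (5 : ℤ) ∣ 2 * x - y) :
    (swapAboveFive (x, y)).1 ^ 2 + 6 * (swapAboveFive (x, y)).2 ^ 2 = x ^ 2 + 6 * y ^ 2 := by
  obtain ⟨e, he, -, h1, h2⟩ := swapAboveFive_spec hxy
  have he : e ^ 2 = 1 := by rcases he with rfl | rfl <;> norm_num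
  have h1 := sq_eq_sq_iff_eq_or_eq_neg.2 h1
  have h2 := sq_eq_sq_iff_eq_or_eq_neg.2 h2
  zify
  refine mul_left_cancel₀ (by norm_num : (25 : ℤ) ≠ 0) ?_
  linear_combination h1 + 6 * h2 + 150 * (y : ℤ) ^ 2 * he

/-- The number of representations of `M` by `x ^ 2 + 6 * y ^ 2` in natural numbers is even if `5`
divides `M` exactly once. -/
theorem even_card_sq_add_six_mul_sq {M : ℕ} (h5 : 5 ∣ M) (h25 : ¬ 25 ∣ M) (h6 : M % 6 = 1)
    {s : Finset (ℕ × ℕ)} (hs : ∀ p, p ∈ s ↔ p.1 ^ 2 + 6 * p.2 ^ 2 = M) : Even #s := by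
  have hx5 : ∀ x y : ℕ, x ^ 2 + 6 * y ^ 2 = M → ¬ 5 ∣ x := by
    rintro x y h ⟨c, rfl⟩
    have hy : 5 ∣ 6 * y ^ 2 := (Nat.dvd_add_right ⟨5 * c ^ 2, by ring⟩).1 (h ▸ h5)
    obtain ⟨d, rfl⟩ := Nat.Prime.dvd_of_dvd_pow (by norm_num)
      ((Nat.Coprime.dvd_mul_left (by norm_num)).1 hy)
    exact h25 ⟨c ^ 2 + 6 * d ^ 2, by rw [← h]; ring⟩
  have hx2 : ∀ x y : ℕ, x ^ 2 + 6 * y ^ 2 = M → ¬ 2 ∣ x := by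
    rintro x y h ⟨c, rfl⟩
    rw [mul_pow] at h
    omega
  have hx3 : ∀ x y : ℕ, x ^ 2 + 6 * y ^ 2 = M → ¬ 3 ∣ x := by
    rintro x y h ⟨c, rfl⟩
    rw [mul_pow] at h
    omega
  have hxy : ∀ x y : ℕ, x ^ 2 + 6 * y ^ 2 = M →
      (5 : ℤ) ∣ 2 * x + y ∨ (5 : ℤ) ∣ 2 * x - y := by
    intro x y h
    have hp : Prime (5 : ℤ) := by norm_num
    refine hp.dvd_or_dvd ?_
    obtain ⟨c, rfl⟩ := h5
    refine ⟨4 * c - 5 * y ^ 2, ?_⟩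
    zify at h
    linear_combination 4 * h
  refine even_card_of_involution swapAboveFive ?_ ?_ ?_
  · rintro ⟨x, y⟩ h
    rw [hs] at h ⊢
    rw [swapAboveFive_norm (hxy x y h), h]
  · rintro ⟨x, y⟩ h
    rw [hs] at h
    exact swapAboveFive_ne (hx2 x y h) (hx3 x y h) (hxy x y h)
  · rintro ⟨x, y⟩ h
    rw [hs] at h
    exact swapAboveFive_conj (hx5 _ _ ((swapAboveFive_norm (hxy x y h)).trans h)) (hxy x y h)

end Parity

/-! ### Divisibility by four -/

section ModFour

variable (R : Type*) [CommRing R]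

/-- The generating function of the number of divisors; its constant coefficient is `0`, because
`Nat.divisors 0 = ∅`. -/
noncomputable def divisorSeries : R⟦X⟧ := PowerSeries.mk fun n => (#n.divisors : R)

lemma modXPow_divisorSeries (K : ℕ) : modXPow R K (divisorSeries R) =
    ∑ i ∈ range K, ∑ j ∈ range K, (modXPow R K X ^ (i + 1)) ^ (j + 1) := by
  simp_rw [← pow_mul, ← map_pow, ← map_sum]
  refine modXPow_eq_iff.2 fun n hn => ?_
  rw [divisorSeries, coeff_mk, ← sum_product', map_sum]
  simp_rw [coeff_X_pow]
  rw [sum_boole]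
  congr 1
  symm
  refine card_bij (fun p _ => p.1 + 1) ?_ ?_ ?_
  · rintro ⟨i, j⟩ h
    simp only [mem_filter, Nat.mem_divisors] at h ⊢
    rw [h.2]
    exact ⟨dvd_mul_right _ _, by positivity⟩
  · rintro ⟨i, j⟩ h ⟨i', j'⟩ h' hij
    simp only [mem_filter] at h h' hij
    obtain rfl : i = i' := by omega
    have := Nat.eq_of_mul_eq_mul_left i.succ_pos (h.2.symm.trans h'.2)
    simp only [Prod.mk.injEq, true_and]
    omega
  · intro d hd
    obtain ⟨⟨e, rfl⟩, h0⟩ := Nat.mem_divisors.1 hd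
    have hd0 := Nat.pos_of_ne_zero (left_ne_zero_of_mul h0)
    have he0 := Nat.pos_of_ne_zero (right_ne_zero_of_mul h0)
    have h1 : d ≤ d * e := Nat.le_mul_of_pos_right _ he0
    have h2 : e ≤ d * e := Nat.le_mul_of_pos_left _ hd0
    refine ⟨(d - 1, e - 1), ?_, by simp; omega⟩
    simp only [mem_filter, mem_product, mem_range]
    refine ⟨⟨by omega, by omega⟩, ?_⟩
    rw [Nat.sub_add_cancel hd0, Nat.sub_add_cancel he0]

variable {R}

/-- Modulo `4`, `f_1 ^ 2 / f_2 = ∏ (1 - X ^ i) / (1 + X ^ i)` is `1 + 2 * ∑ X ^ i / (1 - X ^ i)`, a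
form of Gauss's identity for this theta series. -/
theorem eulerSeries_one_sq (h4 : (4 : R) = 0) :
    eulerSeries R 1 ^ 2 = eulerSeries R 2 * (1 + 2 * divisorSeries R) := by
  refine eq_of_modXPow_eq fun K => ?_
  have h2 : modXPow R K 2 = 2 := map_ofNat _ 2
  have h4' : (4 : R⟦X⟧ ⧸ Ideal.span {(X : R⟦X⟧) ^ K}) = 0 := by
    have h : (4 : R⟦X⟧) = 0 := by rw [← map_ofNat (C (R := R)) 4, h4, map_zero]
    rw [← map_ofNat (modXPow R K) 4, h, map_zero]
  rw [map_mul, map_pow, map_add, map_mul, map_one, h2, modXPow_divisorSeries,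
    modXPow_eulerSeries 1 K.le_succ, modXPow_eulerSeries 2 K.le_succ, pow_one]
  set q := modXPow R K X
  have hq : q ^ K = 0 := modXPow_X_pow le_rfl
  have hprod : ∀ (s : Finset ℕ) (g : ℕ → R⟦X⟧ ⧸ Ideal.span {(X : R⟦X⟧) ^ K}),
      ∏ i ∈ s, (1 + 2 * g i) = 1 + 2 * ∑ i ∈ s, g i := by
    intro s g
    induction s using Finset.induction_on with
    | empty => simp
    | insert a s ha ih =>
      rw [prod_insert ha, sum_insert ha, ih]
      linear_combination g a * (∑ i ∈ s, g i) * h4'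
  rw [← hprod, qProd, qProd, ← prod_mul_distrib, ← prod_pow]
  refine prod_congr rfl fun i _ => ?_
  rw [pow_right_comm q 2]
  set x := q ^ (i + 1)
  have hx : x ^ K = 0 := by rw [← pow_mul, mul_comm, pow_mul, hq, zero_pow (by omega)]
  have hg : (1 - x) * ∑ j ∈ range K, x ^ (j + 1) = x := by
    have h := mul_neg_geom_sum x K
    rw [hx, sub_zero] at h
    simp_rw [pow_succ']
    rw [← mul_sum]
    linear_combination x * h
  linear_combination - 2 * (1 + x) * hg - x * h4'

theorem EOBarSeries_eq_of_four_eq_zero (h4 : (4 : R) = 0) :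
    EOBarSeries R = eulerSeries R 4 + eulerSeries R 4 * (2 * divisorSeries R) +
      eulerSeries R 4 * (2 * expand 2 two_ne_zero (divisorSeries R)) := by
  have h4' : (4 : R⟦X⟧) = 0 := by rw [← map_ofNat (C (R := R)) 4, h4, map_zero]
  have hu : IsUnit (eulerSeries R 2) := by
    rw [isUnit_iff_constantCoeff, eulerSeries, constantCoeff_expand,
      ← coeff_zero_eq_constantCoeff_apply]
    simpa [pentagonal_def] using
      congrArg IsUnit (coeff_pentagonalSeries_pentagonal R 0)
  have h1 := eulerSeries_one_sq h4
  have h2 := EOBarSeries_mul_eulerSeries_one_sq R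
  have h3 : eulerSeries R 2 ^ 2 =
      eulerSeries R 4 * (1 + 2 * expand 2 two_ne_zero (divisorSeries R)) := by
    have h := congrArg (expand 2 two_ne_zero) h1
    simp only [map_mul, map_pow, map_add, map_one, map_ofNat] at h
    have e : expand 2 two_ne_zero (eulerSeries R 2) = eulerSeries R 4 := by
      rw [eulerSeries, ← expand_mul]
      rfl
    rwa [e, ← eulerSeries_eq_expand R 2] at h
  rw [h1] at h2
  have h5 : EOBarSeries R * (1 + 2 * divisorSeries R) = eulerSeries R 2 ^ 2 :=
    hu.mul_left_cancel (by linear_combination h2)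
  rw [h3] at h5
  linear_combination (1 + 2 * divisorSeries R) * h5 -
    (EOBarSeries R * (divisorSeries R + divisorSeries R ^ 2) - eulerSeries R 4 *
      divisorSeries R * expand 2 two_ne_zero (divisorSeries R)) * h4'

/-- `f_4` is supported on the numbers `a = 4 * k * (3 * k - 1) / 2`, for which
`6 * a + 1 = (6 * k - 1) ^ 2`. -/
lemma exists_sq_of_coeff_eulerSeries_four_ne_zero {a : ℕ} (h : coeff a (eulerSeries R 4) ≠ 0) :
    (∃ x, 6 * a + 1 = x ^ 2) := by
  obtain ⟨c, rfl, hc⟩ := coeff_expand_ne_zero _ h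
  have : c ∈ Set.range pentagonal := by
    by_contra hcon
    exact hc (coeff_pentagonalSeries_eq_zero R hcon)
  obtain ⟨k, rfl⟩ := this
  refine ⟨(6 * k - 1).natAbs, ?_⟩
  zify
  rw [sq_abs]
  linear_combination 12 * two_mul_natCast_pentagonal k

lemma two_mul_coeff_eulerSeries_four {x : ℕ} (h4 : (4 : R) = 0) {a : ℕ} (h : 6 * a + 1 = x ^ 2) :
    2 * coeff a (eulerSeries R 4) = 2 := by
  have hk : ∃ k : ℤ, 6 * k - 1 = x ∨ 6 * k - 1 = -x := by
    have h1 : x ^ 2 % 6 = 1 := by omega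
    rw [Nat.pow_mod] at h1
    have h2 : x % 6 < 6 := Nat.mod_lt _ (by norm_num)
    have h3 : x % 6 = 1 ∨ x % 6 = 5 := by
      generalize x % 6 = r at *
      interval_cases r <;> simp_all
    rcases h3 with h3 | h3
    · exact ⟨-(x / 6 : ℕ), by omega⟩
    · exact ⟨(x / 6 : ℕ) + 1, by omega⟩
  obtain ⟨k, hk⟩ := hk
  have hk2 : (6 * k - 1) ^ 2 = (x : ℤ) ^ 2 := by
    rcases hk with hk | hk <;> rw [hk]; ring
  have ha : a = 4 * pentagonal k := by
    have := two_mul_natCast_pentagonal k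
    zify at h ⊢
    linarith
  rw [ha, eulerSeries, coeff_expand_mul, coeff_pentagonalSeries_pentagonal]
  rcases Int.even_or_odd k with hk | hk
  · rw [Int.negOnePow_even _ hk]; simp
  · rw [Int.negOnePow_odd _ hk]; push_cast; linear_combination -h4

lemma two_mul_coeff_divisorSeries (h4 : (4 : R) = 0) (b : ℕ) [Decidable (∃ y, 0 < y ∧ b = y ^ 2)] :
    coeff b (2 * divisorSeries R) = if ∃ y, 0 < y ∧ b = y ^ 2 then 2 else 0 := by
  rw [← map_ofNat (C (R := R)) 2, coeff_C_mul, divisorSeries, coeff_mk]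
  split_ifs with h <;> rw [← odd_card_divisors_iff] at h
  · obtain ⟨c, hc⟩ := h
    rw [hc]; push_cast; linear_combination c * h4
  · obtain ⟨c, hc⟩ := Nat.not_odd_iff_even.1 h
    rw [hc]; push_cast; linear_combination c * h4

theorem coeff_EOBarSeries_eq_zero_of_four_eq_zero (h4 : (4 : R) = 0) {N : ℕ} (h5 : 5 ∣ 6 * N + 1)
    (h25 : ¬ 25 ∣ 6 * N + 1) : coeff N (EOBarSeries R) = 0 := by
  classical
  have hsq : ∀ x y : ℕ, 6 * N + 1 ≠ x ^ 2 + 12 * y ^ 2 := by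
    intro x y h
    have key : ∀ x y : ZMod 5, x ^ 2 + 12 * y ^ 2 = 0 → x = 0 ∧ y = 0 := by decide
    have h0 : ((x ^ 2 + 12 * y ^ 2 : ℕ) : ZMod 5) = 0 := by
      rw [ZMod.natCast_eq_zero_iff, ← h]; exact h5
    obtain ⟨hx, hy⟩ := key x y (by exact_mod_cast h0)
    rw [ZMod.natCast_eq_zero_iff] at hx hy
    obtain ⟨c, rfl⟩ := hx
    obtain ⟨d, rfl⟩ := hy
    exact h25 ⟨c ^ 2 + 12 * d ^ 2, by rw [h]; ring⟩
  rw [EOBarSeries_eq_of_four_eq_zero h4, map_add, map_add]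
  -- `f_4` alone contributes representations of `6 * N + 1` by `x ^ 2`.
  have t1 : coeff N (eulerSeries R 4) = 0 := by
    by_contra h
    obtain ⟨x, hx⟩ := exists_sq_of_coeff_eulerSeries_four_ne_zero h
    exact hsq x 0 (by rw [hx]; ring)
  -- This term contributes representations by `x ^ 2 + 12 * y ^ 2`, which is anisotropic modulo `5`.
  have t3 : coeff N (eulerSeries R 4 * (2 * expand 2 two_ne_zero (divisorSeries R))) = 0 := by
    rw [coeff_mul]
    refine sum_eq_zero fun ⟨a, b⟩ hab => ?_
    rw [HasAntidiagonal.mem_antidiagonal] at hab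
    dsimp only at hab ⊢
    by_contra hcon
    obtain ⟨x, hx⟩ := exists_sq_of_coeff_eulerSeries_four_ne_zero (left_ne_zero_of_mul hcon)
    have hb := right_ne_zero_of_mul hcon
    rw [← map_ofNat (expand (R := R) 2 two_ne_zero) 2, ← map_mul] at hb
    obtain ⟨c, rfl, hc⟩ := coeff_expand_ne_zero _ hb
    rw [two_mul_coeff_divisorSeries h4] at hc
    split_ifs at hc with hy
    · obtain ⟨y, -, rfl⟩ := hy
      exact hsq x y (by rw [← hx, ← hab]; ring)
    · exact hc rfl
  -- This term is twice the number of representations by `x ^ 2 + 6 * y ^ 2`.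
  have t2 : coeff N (eulerSeries R 4 * (2 * divisorSeries R)) = 0 := by
    have hev : Even #{p ∈ range (6 * N + 2) ×ˢ range (6 * N + 2) |
        p.1 ^ 2 + 6 * p.2 ^ 2 = 6 * N + 1} := by
      refine even_card_sq_add_six_mul_sq h5 h25 (by omega) fun ⟨x, y⟩ => ?_
      simp only [mem_filter, mem_product, mem_range, and_iff_right_iff_imp]
      intro h
      constructor <;> nlinarith
    have hcard : #{p ∈ range (6 * N + 2) ×ˢ range (6 * N + 2) |
        p.1 ^ 2 + 6 * p.2 ^ 2 = 6 * N + 1} = #{p ∈ HasAntidiagonal.antidiagonal N |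
          (∃ x, 6 * p.1 + 1 = x ^ 2) ∧ ∃ y, 0 < y ∧ p.2 = y ^ 2} := by
      refine card_bij (fun p _ => ((p.1 ^ 2 - 1) / 6, p.2 ^ 2)) ?_ ?_ ?_
      · rintro ⟨x, y⟩ h
        simp only [mem_filter, HasAntidiagonal.mem_antidiagonal] at h ⊢
        refine ⟨by omega, ⟨x, by omega⟩, y, Nat.pos_of_ne_zero ?_, rfl⟩
        rintro rfl
        exact hsq x 0 h.2.symm
      · rintro ⟨x, y⟩ h ⟨x', y'⟩ h' he
        simp only [mem_filter, Prod.mk.injEq] at h h' he ⊢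
        exact ⟨Nat.pow_left_injective two_ne_zero (by dsimp only; omega),
          Nat.pow_left_injective two_ne_zero he.2⟩
      · rintro ⟨a, b⟩ h
        simp only [mem_filter, HasAntidiagonal.mem_antidiagonal] at h
        obtain ⟨hab, ⟨x, hx⟩, y, hy, rfl⟩ := h
        refine ⟨(x, y), ?_, ?_⟩
        · simp only [mem_filter, mem_product, mem_range]
          refine ⟨⟨by nlinarith, by nlinarith⟩, by omega⟩
        · simp only [Prod.mk.injEq, and_true]
          omega
    rw [hcard] at hev
    rw [coeff_mul]
    have hterm : ∀ p ∈ HasAntidiagonal.antidiagonal N,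
        coeff p.1 (eulerSeries R 4) * coeff p.2 (2 * divisorSeries R) =
        if (∃ x, 6 * p.1 + 1 = x ^ 2) ∧ ∃ y, 0 < y ∧ p.2 = y ^ 2 then 2 else 0 := by
      intro p _
      rw [two_mul_coeff_divisorSeries h4]
      by_cases hx : ∃ x, 6 * p.1 + 1 = x ^ 2
      · obtain ⟨x, hx'⟩ := hx
        have := two_mul_coeff_eulerSeries_four h4 hx'
        rw [mul_ite, mul_comm, this, mul_zero]
        exact if_congr (by simp [hx']) rfl rfl
      · have : coeff p.1 (eulerSeries R 4) = 0 := by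
          by_contra h
          exact hx (exists_sq_of_coeff_eulerSeries_four_ne_zero h)
        rw [this, zero_mul, if_neg fun h => hx h.1]
    rw [sum_congr rfl hterm, ← sum_filter, sum_const]
    obtain ⟨c, hc⟩ := hev
    rw [hc, nsmul_eq_mul]
    push_cast
    linear_combination c * h4
  rw [t1, t2, t3, add_zero, add_zero]

end ModFour

theorem theorem1p3 (t : ℕ) (ht : t ∈ ({1, 2, 3, 4} : Finset ℕ)) (n : ℕ) :
    EOBar (10 * (5 * n + t) + 8) ≡ 0 [MOD 20] := by
  -- For `N = 5 * (5 * n + t) + 4` one has `6 * N + 1 = 25 * (6 * n + 1) + 30 * t`, which is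
  -- divisible by `5` exactly once.
  have hN : 10 * (5 * n + t) + 8 = 2 * (5 * (5 * n + t) + 4) := by ring
  have h5 := coeff_EOBarSeries_zmod_five (5 * n + t)
  have h4 : coeff (5 * (5 * n + t) + 4) (EOBarSeries (ZMod 4)) = 0 := by
    simp only [mem_insert, mem_singleton] at ht
    exact coeff_EOBarSeries_eq_zero_of_four_eq_zero rfl (by omega) (by omega)
  rw [EOBarSeries, coeff_mk, ZMod.natCast_eq_zero_iff] at h4 h5
  rw [hN, Nat.modEq_zero_iff_dvd]
  exact Nat.Coprime.mul_dvd_of_dvd_of_dvd (by norm_num : Nat.Coprime 4 5) h4 h5
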